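/- For a continuous map $\phi:[0,1]\to[0,1]$, $n\ge 1$ and $\varepsilon>0$ let $d_n(x,y)=\max_{0\le k<n}|\phi^k(x)-\phi^k(y)|$, let $\mathrm{sep}(n,\phi,\varepsilon)$ be the maximal cardinality of a set $A\subseteq[0,1]$ with $d_n(x,y)>\varepsilon$ for all distinct $x,y\in A$, and put $\mathrm{sep}(\phi,\varepsilon)=\limsup_{n\to\infty}\frac1n\log \mathrm{sep}(n,\phi,\varepsilon)$. The lower and upper metric mean dimensions of $\phi$ are $$\underline{\mathrm{mdim}}_M([0,1],|\cdot|,\phi)=\liminf_{\varepsilon\to0^+}\frac{\mathrm{sep}(\phi,\varepsilon)}{|\log\varepsilon|},\qquad \overline{\mathrm{mdim}}_M([0,1],|\cdot|,\phi)=\limsup_{\varepsilon\to0^+}\frac{\mathrm{sep}(\phi,\varepsilon)}{|\log\varepsilon|}.$$ Theorem. Let $a,b\in[0,1]$ with $a<b$. Then the set $C_a^b([0,1])$ of all continuous maps $\phi:[0,1]\to[0,1]$ with $\underline{\mathrm{mdim}}_M([0,1],|\cdot|,\phi)=a$ and $\overline{\mathrm{mdim}}_M([0,1],|\cdot|,\phi)=b$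 is dense in the space $C^0([0,1])$ of all continuous maps $[0,1]\to[0,1]$ with the metric $\hat d(\phi,\psi)=\max_{x\in[0,1]}|\phi(x)-\psi(x)|$. -/

import Mathlib

open Filter Topology

/-- The metric `d_n(x, y) = max {d(φ^k x, φ^k y) : 0 ≤ k < n}` on orbit segments of length `n`. -/
noncomputable def dynDist {X : Type*} [MetricSpace X] (φ : X → X) (n : ℕ) (x y : X) : ℝ :=
  ((Finset.range n).sup fun k => nndist (φ^[k] x) (φ^[k] y) : NNReal)

/-- `A` is `(n, φ, ε)`-separated: `d_n(x, y) > ε` for any two distinct points of `A`. -/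
def IsDynSeparated {X : Type*} [MetricSpace X] (φ : X → X) (n : ℕ) (ε : ℝ) (A : Set X) : Prop :=
  A.Pairwise fun x y => ε < dynDist φ n x y

/-- `sep(n, φ, ε)`: the maximal cardinality of an `(n, φ, ε)`-separated set. -/
noncomputable def sepCard {X : Type*} [MetricSpace X] (φ : X → X) (n : ℕ) (ε : ℝ) : ℕ∞ :=
  ⨆ (A : Finset X) (_ : IsDynSeparated φ n ε (A : Set X)), (A.card : ℕ∞)

/-- `sep(φ, ε) = limsup_{n → ∞} (1 / n) log sep(n, φ, ε)`, an extended real number. -/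
noncomputable def sepEntropy {X : Type*} [MetricSpace X] (φ : X → X) (ε : ℝ) : EReal :=
  limsup (fun n : ℕ => ENNReal.log (sepCard φ n ε : ENNReal) / (n : EReal)) atTop

/-- Lower metric mean dimension: `liminf_{ε → 0⁺} sep(φ, ε) / |log ε|`. -/
noncomputable def lowerMetricMeanDim {X : Type*} [MetricSpace X] (φ : X → X) : EReal :=
  liminf (fun ε : ℝ => sepEntropy φ ε / ((|Real.log ε| : ℝ) : EReal)) (𝓝[>] (0 : ℝ))

/-- Upper metric mean dimension: `limsup_{ε → 0⁺} sep(φ, ε) / |log ε|`. -/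
noncomputable def upperMetricMeanDim {X : Type*} [MetricSpace X] (φ : X → X) : EReal :=
  limsup (fun ε : ℝ => sepEntropy φ ε / ((|Real.log ε| : ℝ) : EReal)) (𝓝[>] (0 : ℝ))

/-! The entropy at scale `ε` is squeezed from two sides. If `ε`-close points have images at most a
constant times `V` apart, coding orbits by cells of length `ε` bounds it by `log (V / ε) + O(1)`
(`sepEntropy_le_log_of_modulus`); a horseshoe with `M` legs more than `ε` apart forces at least `log
M` (`log_le_sepEntropy`). Near a fixed point, place zigzags with `2 ^ σ k` legs on intervals of size
`2 ^ (-ℓ k)`. The ratio of entropy to `|log ε|` peaks near `σ k / (σ k + ℓ k)`, when the legs of the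
`k`-th are just resolved, and bottoms near `σ k / (σ k + ℓ (k + 1))`, when the next zigzag takes
over. `exists_horseshoeScales` makes these tend to `b` and `a`; `HorseshoeScales.metricMeanDim_eq`
turns this into the two dimensions. For density, the given map is replaced by a close polynomial,
whose Lipschitz constant costs only `O(1)` in entropy at every scale, and the zigzags are clamped to
stay near it. Around the fixed point the clamp is inactive, so the horseshoes survive. -/

/-! ### Entropy bounds from coding and from horseshoes -/

section Separated

variable {X : Type*} [MetricSpace X] {φ : X → X} {n : ℕ} {ε : ℝ}

theorem lt_dynDist_iff (hε : 0 ≤ ε) {x y : X} :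
    ε < dynDist φ n x y ↔ ∃ k < n, ε < dist (φ^[k] x) (φ^[k] y) := by
  lift ε to NNReal using hε
  unfold dynDist
  rw [NNReal.coe_lt_coe, Finset.lt_sup_iff]
  simp only [Finset.mem_range, ← NNReal.coe_lt_coe, coe_nndist]

theorem sepCard_mono {δ : ℝ} (h : δ ≤ ε) : sepCard φ n ε ≤ sepCard φ n δ :=
  iSup_mono fun _ => iSup_mono' fun hA => ⟨fun _ hx _ hy hxy => h.trans_lt (hA hx hy hxy), le_rfl⟩

theorem EReal.div_natCast_mono (n : ℕ) {x y : EReal} (h : x ≤ y) :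
    x / (n : EReal) ≤ y / (n : EReal) :=
  EReal.div_le_div_right_of_nonneg (by positivity) h

theorem sepEntropy_anti {δ : ℝ} (h : δ ≤ ε) : sepEntropy φ ε ≤ sepEntropy φ δ :=
  limsup_le_limsup (Eventually.of_forall fun n => EReal.div_natCast_mono n
    (ENNReal.log_monotone (by exact_mod_cast sepCard_mono h)))

/-- A separated set contained in one cell of a partition of mesh `ε`, each of whose cells has an
image meeting at most `M` cells. -/
theorem card_le_pow_of_isDynSeparated {ι : Type*} [DecidableEq ι] {κ : X → ι} {M : ℕ}
    (hε : 0 < ε) (hκ : ∀ x y, κ x = κ y → dist x y ≤ ε)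
    (hM : ∀ i, ∃ F : Finset ι, F.card ≤ M ∧ ∀ x, κ x = i → κ (φ x) ∈ F) (n : ℕ) :
    ∀ (A : Finset X) (i : ι), (∀ x ∈ A, κ x = i) → IsDynSeparated φ (n + 1) ε (A : Set X) →
      A.card ≤ M ^ n := by
  classical
  induction n with
  | zero =>
    intro A i hA hs
    rw [pow_zero, Finset.card_le_one]
    intro x hx y hy
    by_contra hxy
    obtain ⟨k, hk, h⟩ := (lt_dynDist_iff hε.le).1 (hs hx hy hxy)
    obtain rfl : k = 0 := by omega
    exact absurd (hκ x y ((hA x hx).trans (hA y hy).symm)) (not_le.2 h)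
  | succ n ih =>
    intro A i hA hs
    obtain ⟨F, hF, hFm⟩ := hM i
    -- Points of one cell are `ε`-close at time 0, so they separate later: `φ` is injective on `A`
    -- with separated image, and induction applies in each of the at most `M` cells met.
    have step : ∀ x ∈ A, ∀ y ∈ A, x ≠ y → ε < dynDist φ (n + 1) (φ x) (φ y) := by
      intro x hx y hy hxy
      obtain ⟨k, hk, h⟩ := (lt_dynDist_iff hε.le).1 (hs hx hy hxy)
      cases k with
      | zero => exact absurd (hκ x y ((hA x hx).trans (hA y hy).symm)) (not_le.2 h)
      | succ k => exact (lt_dynDist_iff hε.le).2 ⟨k, by omega, by simpa using h⟩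
    have inj : Set.InjOn φ (A : Set X) := by
      intro x hx y hy hxy
      by_contra hne
      obtain ⟨k, -, h⟩ := (lt_dynDist_iff hε.le).1 (step x hx y hy hne)
      rw [hxy, dist_self] at h
      exact absurd h (not_lt.2 hε.le)
    have key := Finset.card_le_mul_card_image_of_maps_to (s := A) (t := F)
      (f := fun x => κ (φ x)) (fun x hx => hFm x (hA x hx)) (M ^ n) (by
        intro v _
        rw [← Finset.card_image_of_injOn (f := φ) (inj.mono (Finset.coe_subset.2 (Finset.filter_subset _ _)))]
        refine ih _ v (by
          simp only [Finset.mem_image, Finset.mem_filter]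
          rintro _ ⟨x, ⟨-, h⟩, rfl⟩
          exact h) ?_
        intro p hp q hq hpq
        simp only [Finset.coe_image, Finset.coe_filter, Set.mem_image, Set.mem_ofPred_eq] at hp hq
        obtain ⟨x, ⟨hx, -⟩, rfl⟩ := hp
        obtain ⟨y, ⟨hy, -⟩, rfl⟩ := hq
        exact step x hx y hy (fun h => hpq (h ▸ rfl)))
    calc A.card ≤ M ^ n * F.card := key
      _ ≤ M ^ n * M := Nat.mul_le_mul_left _ hF
      _ = M ^ (n + 1) := (pow_succ _ _).symm

theorem sepCard_succ_le {ι : Type*} [DecidableEq ι] {κ : X → ι} {M : ℕ} (G : Finset ι)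
    (hG : ∀ x, κ x ∈ G) (hε : 0 < ε) (hκ : ∀ x y, κ x = κ y → dist x y ≤ ε)
    (hM : ∀ i, ∃ F : Finset ι, F.card ≤ M ∧ ∀ x, κ x = i → κ (φ x) ∈ F) (n : ℕ) :
    sepCard φ (n + 1) ε ≤ ((M ^ n * G.card : ℕ) : ℕ∞) := by
  classical
  refine iSup₂_le fun A hA => ?_
  have key := Finset.card_le_mul_card_image_of_maps_to (s := A) (t := G)
    (f := κ) (fun x _ => hG x) (M ^ n) (by
      intro v _
      refine card_le_pow_of_isDynSeparated hε hκ hM n _ v (by simp) ?_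
      exact hA.mono (Finset.coe_subset.2 (Finset.filter_subset _ _)))
  exact_mod_cast key

theorem ENNReal.log_natCast_of_pos {m : ℕ} (hm : 0 < m) :
    ENNReal.log (m : ENNReal) = ((Real.log m : ℝ) : EReal) := by
  rw [ENNReal.log_pos_real (by positivity) (by simp)]
  simp

theorem sepEntropy_le_log {ι : Type*} [DecidableEq ι] {κ : X → ι} {M : ℕ} (hM0 : 0 < M)
    (G : Finset ι) (hG : ∀ x, κ x ∈ G) (hε : 0 < ε) (hκ : ∀ x y, κ x = κ y → dist x y ≤ ε)
    (hM : ∀ i, ∃ F : Finset ι, F.card ≤ M ∧ ∀ x, κ x = i → κ (φ x) ∈ F) :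
    sepEntropy φ ε ≤ ((Real.log M : ℝ) : EReal) := by
  -- The number of starting cells washes out after division by `n`; the `+ 1` keeps the logarithm's
  -- argument positive.
  set g : ℕ → ℝ := fun n => Real.log M + Real.log (G.card + 1 : ℕ) / n with hg
  have hlim : Tendsto (fun n => ((g n : ℝ) : EReal)) atTop (𝓝 ((Real.log M : ℝ) : EReal)) := by
    refine (continuous_coe_real_ereal.tendsto _).comp ?_
    simpa only [add_zero] using (tendsto_const_nhds (x := Real.log M)).add
      (tendsto_const_div_atTop_nhds_zero_nat (Real.log (G.card + 1 : ℕ)))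
  rw [← hlim.limsup_eq]
  refine limsup_le_limsup ((eventually_ge_atTop 1).mono fun n hn => ?_)
  obtain ⟨m, rfl⟩ := Nat.exists_eq_add_of_le' hn
  have hpos : 0 < M ^ (m + 1) * (G.card + 1) := by positivity
  have h1 : (sepCard φ (m + 1) ε : ENNReal) ≤ ((M ^ (m + 1) * (G.card + 1) : ℕ) : ENNReal) := by
    have := (sepCard_succ_le (φ := φ) G hG hε hκ hM m).trans
      (Nat.cast_le.2 (Nat.mul_le_mul (Nat.pow_le_pow_right hM0 m.le_succ) G.card.le_succ))
    exact_mod_cast this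
  have h2 := ENNReal.log_monotone h1
  rw [ENNReal.log_natCast_of_pos hpos] at h2
  refine (EReal.div_natCast_mono _ h2).trans_eq ?_
  have h3 : (((m + 1 : ℕ) : ℕ) : EReal) = (((m + 1 : ℕ) : ℝ) : EReal) := by simp
  rw [h3, ← EReal.coe_div, EReal.coe_eq_coe_iff, hg]
  have : (M : ℝ) ≠ 0 := by positivity
  have hm : ((m + 1 : ℕ) : ℝ) ≠ 0 := by positivity
  push_cast at hm ⊢
  rw [Real.log_mul (by positivity) (by positivity), Real.log_pow]
  push_cast
  field_simp

/-- Full shift on the pieces `I j`: every piece is stretched over the union of all of them. -/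
theorem exists_isDynSeparated_card {m : ℕ} (K : Set X) (I : Fin m → Set X) (hK : K.Nonempty)
    (hε : 0 ≤ ε) (hIK : ∀ j, I j ⊆ K) (hcov : ∀ j, K ⊆ φ '' I j)
    (hsep : ∀ i j, i ≠ j → ∀ x ∈ I i, ∀ y ∈ I j, ε < dist x y) (n : ℕ) :
    ∃ A : Finset X, (A : Set X) ⊆ K ∧ IsDynSeparated φ n ε (A : Set X) ∧ A.card = m ^ n := by
  classical
  induction n with
  | zero =>
    obtain ⟨x, hx⟩ := hK
    exact ⟨{x}, by simpa using hx, by simp [IsDynSeparated], by simp⟩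
  | succ n ih =>
    obtain ⟨A, hAK, hA, hc⟩ := ih
    -- Pull `A` back through every piece: different pieces are separated at time 0, points of the
    -- same piece one step later.
    have : ∀ (j : Fin m) (x : A), ∃ y ∈ I j, φ y = x := fun j x => hcov j (hAK x.2)
    choose p hp hpx using this
    have sep : ∀ i j x y, (i, x) ≠ (j, y) → ε < dynDist φ (n + 1) (p i x) (p j y) := by
      intro i j x y hne
      rw [lt_dynDist_iff hε]
      by_cases hij : i = j
      · have hxy : (x : X) ≠ y := fun h => hne (by rw [hij, Subtype.ext h])
        obtain ⟨k, hk, h⟩ := (lt_dynDist_iff hε).1 (hA x.2 y.2 hxy)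
        exact ⟨k + 1, by omega, by simpa [hpx] using h⟩
      · exact ⟨0, by omega, hsep i j hij _ (hp i x) _ (hp j y)⟩
    have inj : Function.Injective fun q : Fin m × A => p q.1 q.2 := by
      rintro ⟨i, x⟩ ⟨j, y⟩ h
      by_contra hne
      obtain ⟨k, -, h'⟩ := (lt_dynDist_iff hε).1 (sep i j x y hne)
      simp only at h
      rw [h, dist_self] at h'
      exact absurd h' (not_lt.2 hε)
    refine ⟨Finset.univ.image fun q : Fin m × A => p q.1 q.2, ?_, ?_, ?_⟩
    · intro z hz
      simp only [Finset.coe_image, Finset.coe_univ, Set.image_univ, Set.mem_range] at hz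
      obtain ⟨q, rfl⟩ := hz
      exact hIK _ (hp _ _)
    · intro z hz z' hz' hne
      simp only [Finset.coe_image, Finset.coe_univ, Set.image_univ, Set.mem_range] at hz hz'
      obtain ⟨q, rfl⟩ := hz
      obtain ⟨q', rfl⟩ := hz'
      exact sep _ _ _ _ (fun h => hne (by rw [show q = q' from h]))
    · rw [Finset.card_image_of_injective _ inj]
      simp [hc, pow_succ, mul_comm]

theorem log_le_sepEntropy {m : ℕ} (hm : 0 < m) (K : Set X) (I : Fin m → Set X) (hK : K.Nonempty)
    (hε : 0 ≤ ε) (hIK : ∀ j, I j ⊆ K) (hcov : ∀ j, K ⊆ φ '' I j)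
    (hsep : ∀ i j, i ≠ j → ∀ x ∈ I i, ∀ y ∈ I j, ε < dist x y) :
    ((Real.log m : ℝ) : EReal) ≤ sepEntropy φ ε := by
  rw [← limsup_const (f := (atTop : Filter ℕ)) ((Real.log m : ℝ) : EReal)]
  refine limsup_le_limsup ((eventually_ge_atTop 1).mono fun n hn => ?_)
  obtain ⟨A, -, hA, hc⟩ := exists_isDynSeparated_card K I hK hε hIK hcov hsep n
  have h1 : ((m ^ n : ℕ) : ENNReal) ≤ (sepCard φ n ε : ENNReal) := by
    have : (A.card : ℕ∞) ≤ sepCard φ n ε := le_iSup₂_of_le A hA le_rfl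
    rw [hc] at this
    exact_mod_cast this
  have h2 := ENNReal.log_monotone h1
  rw [ENNReal.log_natCast_of_pos (by positivity)] at h2
  refine le_trans (le_of_eq ?_) (EReal.div_natCast_mono n h2)
  have h3 : (n : EReal) = ((n : ℝ) : EReal) := by simp
  have : (n : ℝ) ≠ 0 := by positivity
  rw [h3, ← EReal.coe_div, EReal.coe_eq_coe_iff]
  push_cast
  rw [Real.log_pow]
  field_simp

end Separated

theorem sepEntropy_le_log_of_modulus {φ : unitInterval → unitInterval} {ε W : ℝ} (hε : 0 < ε)
    (hW : 0 ≤ W) (h : ∀ x y, dist x y ≤ ε → dist (φ x) (φ y) ≤ W) :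
    sepEntropy φ ε ≤ ((Real.log (2 * (W / ε) + 3) : ℝ) : EReal) := by
  have hWε : 0 ≤ W / ε := by positivity
  -- The image of a cell stays within `D` cells of the cell of any of its points, so it meets at
  -- most `2 * D + 1`.
  set D := ⌊W / ε⌋₊ + 1 with hD
  have hcell : ∀ x y : unitInterval, ⌊(x : ℝ) / ε⌋ = ⌊(y : ℝ) / ε⌋ → dist x y ≤ ε := by
    intro x y hxy
    have := Int.abs_sub_lt_one_of_floor_eq_floor hxy
    rw [← sub_div, abs_div, abs_of_pos hε, div_lt_one hε] at this
    rw [Subtype.dist_eq, Real.dist_eq]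
    exact this.le
  refine (sepEntropy_le_log (κ := fun x : unitInterval => ⌊(x : ℝ) / ε⌋) (M := 2 * D + 1)
    (by omega) (Finset.Icc 0 ⌊1 / ε⌋) ?_ hε hcell ?_).trans ?_
  · intro x
    rw [Finset.mem_Icc]
    exact ⟨Int.floor_nonneg.2 (div_nonneg x.2.1 hε.le),
      Int.floor_le_floor (by have := x.2.2; gcongr)⟩
  · intro i
    by_cases hi : ∃ x : unitInterval, ⌊(x : ℝ) / ε⌋ = i
    · obtain ⟨x, hx⟩ := hi
      refine ⟨Finset.Icc (⌊(φ x : ℝ) / ε⌋ - D) (⌊(φ x : ℝ) / ε⌋ + D), ?_, fun y hy => ?_⟩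
      · rw [Int.card_Icc]
        omega
      · have h1 := h x y (hcell x y (hx.trans hy.symm))
        rw [Subtype.dist_eq, Real.dist_eq] at h1
        have h2 : |(φ x : ℝ) / ε - (φ y : ℝ) / ε| < D := by
          rw [← sub_div, abs_div, abs_of_pos hε]
          refine (div_le_div_of_nonneg_right h1 hε.le).trans_lt ?_
          rw [hD]
          push_cast
          exact Nat.lt_floor_add_one _
        rw [abs_lt] at h2
        rw [Finset.mem_Icc]
        constructor
        · rw [Int.le_floor]
          push_cast
          linarith [Int.floor_le ((φ x : ℝ) / ε)]
        · rw [← Int.lt_add_one_iff, Int.floor_lt]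
          push_cast
          linarith [Int.lt_floor_add_one ((φ x : ℝ) / ε)]
    · exact ⟨∅, by simp, fun x hx => (hi ⟨x, hx⟩).elim⟩
  · rw [EReal.coe_le_coe_iff]
    refine Real.log_le_log (by positivity) ?_
    rw [hD]
    push_cast
    linarith [Nat.floor_le hWε]

/-! ### From entropy estimates to metric mean dimension -/

section Dimension

theorem EReal.div_coe_le {x : EReal} {r s : ℝ} (hs : 0 ≤ s) (h : x ≤ (r : EReal)) :
    x / (s : EReal) ≤ ((r / s : ℝ) : EReal) := by
  rw [EReal.coe_div]
  exact EReal.div_le_div_right_of_nonneg (by exact_mod_cast hs) h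

theorem EReal.le_div_coe {x : EReal} {r s : ℝ} (hs : 0 ≤ s) (h : (r : EReal) ≤ x) :
    ((r / s : ℝ) : EReal) ≤ x / (s : EReal) := by
  rw [EReal.coe_div]
  exact EReal.div_le_div_right_of_nonneg (by exact_mod_cast hs) h

theorem tendsto_abs_log_nhdsGT_zero : Tendsto (fun ε : ℝ => |Real.log ε|) (𝓝[>] 0) atTop :=
  tendsto_abs_atBot_atTop.comp Real.tendsto_log_nhdsGT_zero

variable {X : Type*} [MetricSpace X] {φ : X → X}

theorem upperMetricMeanDim_le {b : ℝ} {r : ℝ → ℝ} (hr : Tendsto r (𝓝[>] 0) (𝓝 b))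
    (h : ∀ᶠ ε in 𝓝[>] (0 : ℝ), sepEntropy φ ε ≤ ((r ε * |Real.log ε| : ℝ) : EReal)) :
    upperMetricMeanDim φ ≤ b := by
  have hlim := (continuous_coe_real_ereal.tendsto b).comp hr
  rw [← hlim.limsup_eq]
  refine limsup_le_limsup ?_
  filter_upwards [h, tendsto_abs_log_nhdsGT_zero.eventually_gt_atTop 0] with ε h1 h2
  have := EReal.div_coe_le h2.le h1
  rwa [mul_div_cancel_right₀ _ h2.ne'] at this

theorem le_lowerMetricMeanDim {a : ℝ} {r : ℝ → ℝ} (hr : Tendsto r (𝓝[>] 0) (𝓝 a))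
    (h : ∀ᶠ ε in 𝓝[>] (0 : ℝ), ((r ε * |Real.log ε| : ℝ) : EReal) ≤ sepEntropy φ ε) :
    a ≤ lowerMetricMeanDim φ := by
  have hlim := (continuous_coe_real_ereal.tendsto a).comp hr
  rw [← hlim.liminf_eq]
  refine liminf_le_liminf ?_
  filter_upwards [h, tendsto_abs_log_nhdsGT_zero.eventually_gt_atTop 0] with ε h1 h2
  have := EReal.le_div_coe h2.le h1
  rwa [mul_div_cancel_right₀ _ h2.ne'] at this

theorem tendsto_two_pow_inv_nhdsGT {N : ℕ → ℕ} (hN : Tendsto N atTop atTop) :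
    Tendsto (fun k => ((2 : ℝ) ^ N k)⁻¹) atTop (𝓝[>] 0) := by
  refine tendsto_nhdsWithin_iff.2 ⟨?_, Eventually.of_forall fun k => by
    simp only [Set.mem_Ioi]; positivity⟩
  exact (tendsto_inv_atTop_zero.comp (tendsto_pow_atTop_atTop_of_one_lt one_lt_two)).comp hN

theorem abs_log_two_pow_inv (N : ℕ) : |Real.log ((2 : ℝ) ^ N)⁻¹| = N * Real.log 2 := by
  rw [Real.log_inv, abs_neg, Real.log_pow, abs_of_nonneg (by positivity)]

/-- A limsup along one sequence of scales is at most the full limsup. -/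
theorem le_upperMetricMeanDim {b : ℝ} {N : ℕ → ℕ} {r : ℕ → ℝ} (hN : Tendsto N atTop atTop)
    (hr : Tendsto (fun k => r k / N k) atTop (𝓝 b))
    (h : ∀ k, ((r k * Real.log 2 : ℝ) : EReal) ≤ sepEntropy φ ((2 : ℝ) ^ N k)⁻¹) :
    b ≤ upperMetricMeanDim φ := by
  have hlim := (continuous_coe_real_ereal.tendsto b).comp hr
  rw [← hlim.limsup_eq]
  refine le_trans ?_ (limsup_le_limsup_of_le (tendsto_two_pow_inv_nhdsGT hN))
  rw [← limsup_comp]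
  refine limsup_le_limsup (Eventually.of_forall fun k => ?_)
  have := EReal.le_div_coe (abs_nonneg (Real.log ((2 : ℝ) ^ N k)⁻¹)) (h k)
  rwa [abs_log_two_pow_inv, mul_div_mul_right _ _ (Real.log_pos one_lt_two).ne',
    ← abs_log_two_pow_inv] at this

theorem lowerMetricMeanDim_le {a : ℝ} {N : ℕ → ℕ} {r : ℕ → ℝ} (hN : Tendsto N atTop atTop)
    (hr : Tendsto (fun k => r k / N k) atTop (𝓝 a))
    (h : ∀ k, sepEntropy φ ((2 : ℝ) ^ N k)⁻¹ ≤ ((r k * Real.log 2 : ℝ) : EReal)) :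
    lowerMetricMeanDim φ ≤ a := by
  have hlim := (continuous_coe_real_ereal.tendsto a).comp hr
  rw [← hlim.liminf_eq]
  refine (liminf_le_liminf_of_le (tendsto_two_pow_inv_nhdsGT hN)).trans ?_
  rw [← liminf_comp]
  refine liminf_le_liminf (Eventually.of_forall fun k => ?_)
  have := EReal.div_coe_le (abs_nonneg (Real.log ((2 : ℝ) ^ N k)⁻¹)) (h k)
  rwa [abs_log_two_pow_inv, mul_div_mul_right _ _ (Real.log_pos one_lt_two).ne',
    ← abs_log_two_pow_inv] at this

end Dimension

/-! ### Dimensions determined by the scales -/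

/-- Scales of horseshoes: the `k`-th one lives at scale `2 ^ (-ℓ k)` and has `2 ^ σ k` legs. -/
structure HorseshoeScales (a b : ℝ) (ℓ σ : ℕ → ℕ) : Prop where
  strictMono : StrictMono ℓ
  mono : Monotone σ
  two_le : 2 ≤ σ 0
  upper : ∀ k, σ k * (1 - b) ≤ b * ℓ k
  lower : ∀ k, a * ℓ (k + 1) ≤ (1 - a) * σ k
  tendsto_upper : Tendsto (fun k => (σ k : ℝ) / (σ k + ℓ k)) atTop (𝓝 b)
  tendsto_lower : Tendsto (fun k => (σ k : ℝ) / (σ k + ℓ (k + 1))) atTop (𝓝 a)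

/-- A minimum is at most the geometric mean with weights `1 - b` and `b`; the powers of 2 then
cancel favourably. -/
theorem min_two_pow_le_rpow {b ε : ℝ} (hb : b ∈ Set.Icc (0 : ℝ) 1) (hε : 0 < ε) {ℓ σ : ℕ}
    (h : σ * (1 - b) ≤ b * ℓ) : min (2 ^ σ * ε) ((2 : ℝ) ^ ℓ)⁻¹ ≤ ε ^ (1 - b) := by
  set m := min (2 ^ σ * ε) ((2 : ℝ) ^ ℓ)⁻¹ with hm
  have hm0 : 0 < m := by positivity
  have hb0 := hb.1
  have hb1 : 0 ≤ 1 - b := by linarith [hb.2]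
  calc m = m ^ (1 - b) * m ^ b := by rw [← Real.rpow_add hm0]; simp
    _ ≤ (2 ^ σ * ε) ^ (1 - b) * (((2 : ℝ) ^ ℓ)⁻¹) ^ b := by
        gcongr
        · exact min_le_left _ _
        · exact min_le_right _ _
    _ = (2 : ℝ) ^ (σ * (1 - b) - b * ℓ) * ε ^ (1 - b) := by
        rw [Real.mul_rpow (by positivity) hε.le, ← Real.rpow_natCast, ← Real.rpow_natCast,
          ← Real.rpow_mul two_pos.le, ← Real.rpow_neg two_pos.le, ← Real.rpow_mul two_pos.le,
          mul_right_comm, ← Real.rpow_add two_pos]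
        congr 2
        ring
    _ ≤ 1 * ε ^ (1 - b) := by
        gcongr
        exact Real.rpow_le_one_of_one_le_of_nonpos one_le_two (by linarith)
    _ = ε ^ (1 - b) := one_mul _

namespace HorseshoeScales

variable {a b : ℝ} {ℓ σ : ℕ → ℕ}

theorem two_le' (h : HorseshoeScales a b ℓ σ) (k : ℕ) : 2 ≤ σ k :=
  h.two_le.trans (h.mono (Nat.zero_le k))

theorem strictMono_add (h : HorseshoeScales a b ℓ σ) : StrictMono fun k => ℓ k + σ k :=
  h.strictMono.add_monotone h.mono

/-- Every scale `2 ^ (-N)` is well resolved by one of the horseshoes. -/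
theorem exists_resolving (h : HorseshoeScales a b ℓ σ) (ha : a ∈ Set.Icc (0 : ℝ) 1) {N : ℕ}
    (hN : ℓ 0 + σ 0 ≤ N) :
    ∃ k ρ, ρ ≤ σ k ∧ ℓ k + σ k + 2 ≤ N + ρ ∧ a * N - 2 ≤ (σ k : ℝ) - ρ := by
  obtain ⟨k, hk, hk'⟩ : ∃ k, ℓ k + σ k ≤ N ∧ N < ℓ (k + 1) + σ (k + 1) := by
    by_contra! hcon
    have : ∀ k, ℓ k + σ k ≤ N := fun k => by
      induction k with
      | zero => exact hN
      | succ k ih => exact hcon k ih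
    have h1 := this (N + 1)
    have h2 := h.strictMono_add.id_le (N + 1)
    simp only [id] at h2
    omega
  have hlow := h.lower k
  have ha0 := ha.1
  have ha1 : 0 ≤ 1 - a := by linarith [ha.2]
  rcases le_or_gt N (σ k + ℓ (k + 1)) with hc | hc
  -- `ρ = 2` offsets the factor `1 / 4` in the separation of legs.
  · refine ⟨k, 2, h.two_le' k, by omega, ?_⟩
    have hc' : (N : ℝ) ≤ σ k + ℓ (k + 1) := by exact_mod_cast hc
    have := mul_le_mul_of_nonneg_left hc' ha0
    push_cast
    linarith
  · have h2 := h.two_le' k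
    -- Horseshoe `k + 1` may be too fine here; thinning its legs by `2 ^ ρ` leaves `2 ^ (N - ℓ (k +
    -- 1) - 2)` of them.
    refine ⟨k + 1, ℓ (k + 1) + σ (k + 1) + 2 - N, by omega, by omega, ?_⟩
    rw [Nat.cast_sub (by omega)]
    have hc' : (σ k : ℝ) + ℓ (k + 1) ≤ N := by exact_mod_cast hc.le
    have := mul_le_mul_of_nonneg_left hc' ha1
    push_cast
    linarith

/-- At this scale the stretching by horseshoe `k` equals the size of horseshoe `k + 1`: earlier ones
stretch less, later ones are smaller. -/
theorem lower_min_le (h : HorseshoeScales a b ℓ σ) (k j : ℕ) :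
    min (2 ^ σ j * ((2 : ℝ) ^ (ℓ (k + 1) + σ k))⁻¹) ((2 : ℝ) ^ ℓ j)⁻¹
      ≤ 2 ^ σ k * ((2 : ℝ) ^ (ℓ (k + 1) + σ k))⁻¹ := by
  rcases le_or_gt j k with hj | hj
  · refine (min_le_left _ _).trans ?_
    gcongr
    · exact one_le_two
    · exact h.mono hj
  · refine (min_le_right _ _).trans ?_
    rw [pow_add, mul_inv, mul_left_comm, mul_inv_cancel₀ (by positivity), mul_one]
    gcongr
    · exact one_le_two
    · exact h.strictMono.monotone hj

theorem metricMeanDim_eq (h : HorseshoeScales a b ℓ σ) (ha : a ∈ Set.Icc (0 : ℝ) 1)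
    (hb : b ∈ Set.Icc (0 : ℝ) 1) {φ : unitInterval → unitInterval} {C : ℝ} (hC : 0 ≤ C)
    (hmod : ∀ ε V : ℝ, 0 < ε → ε ≤ V → (∀ k, min (2 ^ σ k * ε) ((2 : ℝ) ^ ℓ k)⁻¹ ≤ V) →
      ∀ x y, dist x y ≤ ε → dist (φ x) (φ y) ≤ C * V)
    (hshoe : ∀ k ρ, ρ ≤ σ k → ((((σ k : ℝ) - ρ) * Real.log 2 : ℝ) : EReal) ≤
      sepEntropy φ (2 ^ ρ * ((2 : ℝ) ^ (ℓ k + σ k + 2))⁻¹)) :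
    lowerMetricMeanDim φ = a ∧ upperMetricMeanDim φ = b := by
  have hent : ∀ ε V : ℝ, 0 < ε → ε ≤ V → (∀ k, min (2 ^ σ k * ε) ((2 : ℝ) ^ ℓ k)⁻¹ ≤ V) →
      sepEntropy φ ε ≤ ((Real.log (2 * C + 3) + Real.log (V / ε) : ℝ) : EReal) := by
    intro ε V hε hεV hV
    have hV0 : 0 < V := hε.trans_le hεV
    refine (sepEntropy_le_log_of_modulus hε (by positivity) (hmod ε V hε hεV hV)).trans ?_
    rw [EReal.coe_le_coe_iff, ← Real.log_mul (by positivity) (by positivity)]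
    refine Real.log_le_log (by positivity) ?_
    have : 1 ≤ V / ε := (one_le_div hε).2 hεV
    rw [mul_div_assoc]
    linarith
  have hlog2 := Real.log_pos one_lt_two
  have hℓ : Tendsto ℓ atTop atTop := h.strictMono.tendsto_atTop
  refine ⟨le_antisymm ?_ ?_, le_antisymm ?_ ?_⟩
  · have hN : Tendsto (fun k => ℓ (k + 1) + σ k) atTop atTop :=
      tendsto_atTop_mono (fun k => Nat.le_add_right _ _) (hℓ.comp (tendsto_add_atTop_nat 1))
    refine lowerMetricMeanDim_le (N := fun k => ℓ (k + 1) + σ k)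
      (r := fun k => σ k + Real.log (2 * C + 3) / Real.log 2) hN ?_ fun k => ?_
    · have := h.tendsto_lower.add ((tendsto_const_div_atTop_nhds_zero_nat
        (Real.log (2 * C + 3) / Real.log 2)).comp hN)
      rw [add_zero] at this
      refine this.congr fun k => ?_
      simp only [Function.comp_apply]
      push_cast
      rw [add_comm (ℓ (k + 1) : ℝ), add_div]
    · refine (hent _ (2 ^ σ k * ((2 : ℝ) ^ (ℓ (k + 1) + σ k))⁻¹) (by positivity) ?_
        (h.lower_min_le k)).trans_eq ?_
      · exact le_mul_of_one_le_left (by positivity) (one_le_pow₀ one_le_two)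
      · rw [EReal.coe_eq_coe_iff, mul_div_cancel_right₀ _ (by positivity), Real.log_pow]
        field_simp
        ring
  -- Of the three lost binary digits, two come from `exists_resolving` and one from rounding to `N`.
  · refine le_lowerMetricMeanDim
      (r := fun ε => a - (3 * Real.log 2) / |Real.log ε|) ?_ ?_
    · simpa using (tendsto_const_nhds (x := a)).sub
        (tendsto_abs_log_nhdsGT_zero.const_div_atTop (3 * Real.log 2))
    · filter_upwards [self_mem_nhdsWithin, Ioo_mem_nhdsGT one_pos,
        tendsto_abs_log_nhdsGT_zero.eventually_ge_atTop ((ℓ 0 + σ 0 : ℕ) * Real.log 2)]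
        with ε hε hε1 hεN
      have hε0 : 0 < ε := hε
      have habs : |Real.log ε| = - Real.log ε := abs_of_neg (Real.log_neg hε0 hε1.2)
      have hpos : 0 < |Real.log ε| := by rw [habs]; linarith [Real.log_neg hε0 hε1.2]
      set N := ⌊|Real.log ε| / Real.log 2⌋₊ with hNdef
      have hN0 : ℓ 0 + σ 0 ≤ N := Nat.le_floor ((le_div_iff₀ hlog2).2 hεN)
      have hN1 : N * Real.log 2 ≤ |Real.log ε| :=
        (le_div_iff₀ hlog2).1 (Nat.floor_le (by positivity))
      have hN2 : |Real.log ε| < (N + 1) * Real.log 2 :=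
        (div_lt_iff₀ hlog2).1 (Nat.lt_floor_add_one _)
      obtain ⟨k, ρ, hρ, hk, hak⟩ := h.exists_resolving ha hN0
      have hscale : ε ≤ 2 ^ ρ * ((2 : ℝ) ^ (ℓ k + σ k + 2))⁻¹ := by
        have h1 : ε ≤ ((2 : ℝ) ^ N)⁻¹ := by
          rw [← Real.log_le_log_iff hε0 (by positivity), Real.log_inv, Real.log_pow]
          linarith
        have h2 : (2 : ℝ) ^ (ℓ k + σ k + 2) ≤ 2 ^ N * 2 ^ ρ := by
          rw [← pow_add]
          exact pow_le_pow_right₀ one_le_two hk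
        refine h1.trans ?_
        rw [← div_eq_mul_inv, le_div_iff₀ (by positivity), inv_mul_le_iff₀ (by positivity)]
        exact h2
      refine le_trans ?_ ((hshoe k ρ hρ).trans (sepEntropy_anti hscale))
      rw [EReal.coe_le_coe_iff, sub_mul, div_mul_cancel₀ _ hpos.ne']
      have h3 := mul_le_mul_of_nonneg_left hN2.le ha.1
      have h4 := mul_le_mul_of_nonneg_right hak hlog2.le
      have h5 := mul_le_mul_of_nonneg_right ha.2 hlog2.le
      linarith
  · refine upperMetricMeanDim_le
      (r := fun ε => b + Real.log (2 * C + 3) / |Real.log ε|) ?_ ?_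
    · simpa using (tendsto_const_nhds (x := b)).add
        (tendsto_abs_log_nhdsGT_zero.const_div_atTop (Real.log (2 * C + 3)))
    · filter_upwards [self_mem_nhdsWithin, Ioo_mem_nhdsGT one_pos] with ε hε hε1
      have hε0 : 0 < ε := hε
      have habs : |Real.log ε| = - Real.log ε := abs_of_neg (Real.log_neg hε0 hε1.2)
      have hpos : 0 < |Real.log ε| := by rw [habs]; linarith [Real.log_neg hε0 hε1.2]
      refine (hent ε (ε ^ (1 - b)) hε0 ?_
        fun k => min_two_pow_le_rpow hb hε0 (h.upper k)).trans_eq ?_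
      · exact Real.self_le_rpow_of_le_one hε0.le hε1.2.le (by linarith [hb.1])
      · rw [EReal.coe_eq_coe_iff, add_mul, div_mul_cancel₀ _ hpos.ne',
          Real.log_div (by positivity) (by positivity), Real.log_rpow hε0, habs]
        ring
  · have hN : Tendsto (fun k => ℓ k + σ k + 2) atTop atTop :=
      tendsto_atTop_mono (fun k => by omega) hℓ
    refine le_upperMetricMeanDim (N := fun k => ℓ k + σ k + 2) (r := fun k => σ k) hN ?_
      fun k => ?_
    · have hz : Tendsto (fun k => 1 + 2 / ((ℓ k + σ k : ℕ) : ℝ)) atTop (𝓝 1) := by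
        simpa using (tendsto_const_nhds (x := (1 : ℝ))).add
          ((tendsto_const_div_atTop_nhds_zero_nat (2 : ℝ)).comp
            (tendsto_atTop_mono (fun k => Nat.le_add_right (ℓ k) (σ k)) hℓ))
      have := h.tendsto_upper.div hz one_ne_zero
      rw [div_one] at this
      refine this.congr fun k => ?_
      have h2 : (2 : ℝ) ≤ σ k := by exact_mod_cast h.two_le' k
      have h3 : (0 : ℝ) ≤ ℓ k := Nat.cast_nonneg _
      simp only [Pi.div_apply]
      push_cast
      have h4 : (σ k : ℝ) + ℓ k ≠ 0 := by positivity
      have h5 : (ℓ k : ℝ) + σ k ≠ 0 := by positivity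
      have h6 : (ℓ k : ℝ) + σ k + 2 ≠ 0 := by positivity
      field_simp
      ring
    · simpa using hshoe k 0 (Nat.zero_le _)

end HorseshoeScales

/-! ### Construction of the scales -/

/-- A map `S` of the naturals growing as fast as `S / (S + id) → b` and `S / (S + id) ≤ b` allow. -/
theorem exists_monotone_ratio {b : ℝ} (hb0 : 0 < b) (hb1 : b ≤ 1) :
    ∃ S : ℕ → ℕ, Monotone S ∧ Tendsto S atTop atTop ∧ (∀ l, S l * (1 - b) ≤ b * l) ∧
      Tendsto (fun l => (S l : ℝ) / (S l + l)) atTop (𝓝 b) := by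
  rcases hb1.eq_or_lt with rfl | hb1
  · refine ⟨fun l => l * l, fun x y h => Nat.mul_le_mul h h, tendsto_atTop_mono
      (fun l => Nat.le_mul_self l) tendsto_id, fun l => by simp, ?_⟩
    have : Tendsto (fun l : ℕ => 1 - 1 / ((l : ℝ) + 1)) atTop (𝓝 (1 - 0)) :=
      tendsto_const_nhds.sub tendsto_one_div_add_atTop_nhds_zero_nat
    rw [sub_zero] at this
    refine this.congr' ((eventually_ge_atTop 1).mono fun l hl => ?_)
    have : (0 : ℝ) < l := by exact_mod_cast hl
    push_cast
    field_simp
    ring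
  · have h1b : 0 < 1 - b := by linarith
    set c := b / (1 - b) with hc
    have hc0 : 0 < c := by positivity
    have hS : Tendsto (fun l : ℕ => ((⌊c * l⌋₊ : ℕ) : ℝ) / l) atTop (𝓝 c) :=
      (tendsto_nat_floor_mul_div_atTop hc0.le).comp tendsto_natCast_atTop_atTop
    refine ⟨fun l => ⌊c * l⌋₊, fun x y h => Nat.floor_le_floor (by gcongr), ?_, fun l => ?_, ?_⟩
    · exact tendsto_nat_floor_atTop.comp (tendsto_natCast_atTop_atTop.const_mul_atTop hc0)
    · have := Nat.floor_le (show 0 ≤ c * (l : ℝ) by positivity)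
      have h2 := mul_le_mul_of_nonneg_right this h1b.le
      refine h2.trans_eq ?_
      rw [hc]
      field_simp
    · have hlim := hS.div (hS.add (tendsto_const_nhds (x := (1 : ℝ)))) (by positivity)
      have hcb : c / (c + 1) = b := by
        rw [hc]
        field_simp
        ring
      rw [hcb] at hlim
      refine hlim.congr' ((eventually_ge_atTop 1).mono fun l hl => ?_)
      have : (0 : ℝ) < l := by exact_mod_cast hl
      simp only [Pi.div_apply]
      field_simp

theorem exists_horseshoeScales {a b : ℝ} (ha : 0 ≤ a) (hb : b ≤ 1) (hab : a < b) (m : ℕ) :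
    ∃ ℓ σ : ℕ → ℕ, m ≤ ℓ 0 ∧ HorseshoeScales a b ℓ σ := by
  obtain ⟨S, hSm, hSt, hSb, hSl⟩ := exists_monotone_ratio (ha.trans_lt hab) hb
  -- Using `1 - a` swaps the roles: `s / (s + T s)` tends to `a`. The scales alternate `S` and `T`.
  obtain ⟨T, hTm, hTt, hTb, hTl⟩ := exists_monotone_ratio (b := 1 - a) (by linarith) (by linarith)
  have hTl' : Tendsto (fun s : ℕ => (s : ℝ) / (s + T s)) atTop (𝓝 a) := by
    have := (tendsto_const_nhds (x := (1 : ℝ))).sub hTl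
    rw [sub_sub_cancel] at this
    refine this.congr' ((eventually_ge_atTop 1).mono fun s hs => ?_)
    have h1 : (0 : ℝ) < s := by exact_mod_cast hs
    have h2 : (0 : ℝ) ≤ T s := Nat.cast_nonneg _
    have h3 : (T s : ℝ) + s ≠ 0 := by positivity
    have h4 : (s : ℝ) + T s ≠ 0 := by positivity
    field_simp
    ring
  -- Strictness of `a < b` is what makes `ℓ` increase.
  have hgrow : ∀ᶠ l in atTop, l < T (S l) := by
    filter_upwards [(hTl'.comp hSt).eventually_lt_const (show a < (a + b) / 2 by linarith),
      hSl.eventually_const_lt (show (a + b) / 2 < b by linarith),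
      hSt.eventually_ge_atTop 1] with l h1 h2 h3
    have h4 := h1.trans h2
    simp only [Function.comp_apply] at h4
    have h5 : (0 : ℝ) < S l := by exact_mod_cast h3
    rw [div_lt_div_iff_of_pos_left h5 (by positivity) (by positivity)] at h4
    have : (l : ℝ) < T (S l) := by linarith
    exact_mod_cast this
  obtain ⟨l₀, hl₀⟩ := eventually_atTop.1 (hgrow.and (hSt.eventually_ge_atTop 2))
  set ℓ : ℕ → ℕ := fun k => (T ∘ S)^[k] (max m l₀) with hℓ
  have hsucc : ∀ k, ℓ (k + 1) = T (S (ℓ k)) := fun k => Function.iterate_succ_apply' _ _ _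
  have hge : ∀ k, l₀ ≤ ℓ k := fun k => by
    induction k with
    | zero => exact le_max_right _ _
    | succ k ih => rw [hsucc]; exact ih.trans (hl₀ _ ih).1.le
  have hmono : StrictMono ℓ := strictMono_nat_of_lt_succ fun k => by
    rw [hsucc]; exact (hl₀ _ (hge k)).1
  refine ⟨ℓ, fun k => S (ℓ k), le_max_left _ _, hmono, hSm.comp hmono.monotone,
    (hl₀ _ (hge 0)).2, fun k => hSb _, fun k => ?_, hSl.comp hmono.tendsto_atTop, ?_⟩
  · have := hTb (S (ℓ k))
    rw [hsucc]
    linarith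
  · have := hTl'.comp (hSt.comp hmono.tendsto_atTop)
    refine this.congr fun k => ?_
    simp only [Function.comp_apply, hsucc]

/-! ### Zigzags and their superposition -/

/-- The zeros of a zigzag with `2 ^ σ` legs on the interval `[2 ^ (-ℓ), 2 * 2 ^ (-ℓ)]`. -/
def zigzagZeros (ℓ σ : ℕ) : Set ℝ :=
  {x | x ≤ ((2 : ℝ) ^ ℓ)⁻¹ ∨ 2 * ((2 : ℝ) ^ ℓ)⁻¹ ≤ x ∨ ∃ m : ℤ, x = m * ((2 : ℝ) ^ (ℓ + σ))⁻¹}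

/-- The zigzag with `2 ^ σ` legs on `[2 ^ (-ℓ), 2 * 2 ^ (-ℓ)]`, extended by zero. -/
noncomputable def zigzag (ℓ σ : ℕ) (x : ℝ) : ℝ :=
  4 * 2 ^ σ * Metric.infDist x (zigzagZeros ℓ σ)

section Zigzag

variable {ℓ σ : ℕ}

theorem zigzag_nonneg (x : ℝ) : 0 ≤ zigzag ℓ σ x :=
  mul_nonneg (by positivity) Metric.infDist_nonneg

theorem zigzag_eq_zero {x : ℝ} (hx : x ∈ zigzagZeros ℓ σ) : zigzag ℓ σ x = 0 := by
  rw [zigzag, Metric.infDist_zero_of_mem hx, mul_zero]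

theorem two_pow_mul_inv (ℓ σ : ℕ) : (2 : ℝ) ^ σ * ((2 : ℝ) ^ (ℓ + σ))⁻¹ = ((2 : ℝ) ^ ℓ)⁻¹ := by
  rw [pow_add, mul_inv, mul_left_comm, mul_inv_cancel₀ (by positivity), mul_one]

theorem zigzag_le (x : ℝ) : zigzag ℓ σ x ≤ 4 * ((2 : ℝ) ^ ℓ)⁻¹ := by
  rw [← two_pow_mul_inv ℓ σ, zigzag, mul_assoc]
  set w := ((2 : ℝ) ^ (ℓ + σ))⁻¹ with hw
  have hw0 : 0 < w := by positivity
  have hz : (⌊x / w⌋ : ℝ) * w ∈ zigzagZeros ℓ σ := Or.inr (Or.inr ⟨_, rfl⟩)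
  have h1 := Metric.infDist_le_dist_of_mem (x := x) hz
  have h2 : dist x (⌊x / w⌋ * w) ≤ w := by
    have h3 := (le_div_iff₀ hw0).1 (Int.floor_le (x / w))
    have h4 := (div_lt_iff₀ hw0).1 (Int.lt_floor_add_one (x / w))
    rw [Real.dist_eq, abs_of_nonneg (by linarith)]
    linarith
  gcongr
  exact h1.trans h2

theorem zigzag_lipschitz (x y : ℝ) : |zigzag ℓ σ x - zigzag ℓ σ y| ≤ 4 * (2 ^ σ * |x - y|) := by
  have h := (Metric.lipschitz_infDist_pt (zigzagZeros ℓ σ)).dist_le_mul x y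
  rw [Real.dist_eq, Real.dist_eq, NNReal.coe_one, one_mul] at h
  rw [zigzag, zigzag, ← mul_sub, abs_mul, abs_of_nonneg (by positivity), mul_assoc]
  gcongr

theorem zigzag_modulus (x y : ℝ) :
    |zigzag ℓ σ x - zigzag ℓ σ y| ≤ 4 * min (2 ^ σ * |x - y|) ((2 : ℝ) ^ ℓ)⁻¹ := by
  rw [mul_min_of_nonneg _ _ (by norm_num)]
  refine le_min (zigzag_lipschitz x y) ?_
  rw [abs_le]
  constructor <;> linarith [zigzag_le (ℓ := ℓ) (σ := σ) x, zigzag_le (ℓ := ℓ) (σ := σ) y,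
    zigzag_nonneg (ℓ := ℓ) (σ := σ) x, zigzag_nonneg (ℓ := ℓ) (σ := σ) y]

theorem continuous_zigzag : Continuous (zigzag ℓ σ) :=
  continuous_const.mul (Metric.continuous_infDist_pt _)

/-- The factor 4 in `zigzag` lifts each midpoint to the right end of the supporting interval, so
half a leg already covers that interval. -/
theorem le_zigzag_midpoint {j : ℕ} (h1 : 2 ^ σ ≤ j) (h2 : j < 2 * 2 ^ σ) :
    2 * ((2 : ℝ) ^ ℓ)⁻¹ ≤ zigzag ℓ σ ((j + 1 / 2) * ((2 : ℝ) ^ (ℓ + σ))⁻¹) := by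
  have h1' : (2 : ℝ) ^ σ ≤ j := by exact_mod_cast h1
  have h2' : (j : ℝ) + 1 ≤ 2 * 2 ^ σ := by exact_mod_cast h2
  have hL := two_pow_mul_inv ℓ σ
  rw [zigzag, ← hL]
  set w := ((2 : ℝ) ^ (ℓ + σ))⁻¹ with hw
  have hw0 : 0 < w := by positivity
  have key : w / 2 ≤ Metric.infDist ((j + 1 / 2) * w) (zigzagZeros ℓ σ) := by
    have hne : (zigzagZeros ℓ σ).Nonempty := ⟨0, Or.inl (by positivity)⟩
    rw [Metric.le_infDist hne]
    rintro y (hy | hy | ⟨m, rfl⟩)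
    · rw [Real.dist_eq]
      refine le_trans ?_ (le_abs_self _)
      have := mul_le_mul_of_nonneg_right h1' hw0.le
      rw [hL] at this
      linarith
    · rw [Real.dist_eq]
      refine le_trans ?_ (neg_le_abs _)
      have := mul_le_mul_of_nonneg_right h2' hw0.le
      rw [mul_assoc, hL] at this
      linarith
    · rw [Real.dist_eq, ← sub_mul, abs_mul, abs_of_pos hw0, div_eq_inv_mul]
      gcongr
      rcases le_or_gt m j with hm | hm
      · have : (m : ℝ) ≤ j := by exact_mod_cast hm
        rw [le_abs]
        left
        linarith
      · have : (j : ℝ) + 1 ≤ m := by exact_mod_cast hm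
        rw [le_abs]
        right
        linarith
  calc 2 * (2 ^ σ * w) = 4 * 2 ^ σ * (w / 2) := by ring
    _ ≤ _ := by gcongr

theorem zigzag_surjOn {j : ℕ} (h1 : 2 ^ σ ≤ j) (h2 : j < 2 * 2 ^ σ) :
    Set.Icc 0 (2 * ((2 : ℝ) ^ ℓ)⁻¹) ⊆ zigzag ℓ σ ''
      Set.Icc (j * ((2 : ℝ) ^ (ℓ + σ))⁻¹) ((j + 1 / 2) * ((2 : ℝ) ^ (ℓ + σ))⁻¹) := by
  have hle : (j : ℝ) * ((2 : ℝ) ^ (ℓ + σ))⁻¹ ≤ (j + 1 / 2) * ((2 : ℝ) ^ (ℓ + σ))⁻¹ := by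
    gcongr
    linarith
  refine subset_trans ?_ (intermediate_value_Icc hle continuous_zigzag.continuousOn)
  refine Set.Icc_subset_Icc ?_ (le_zigzag_midpoint h1 h2)
  exact (zigzag_eq_zero (Or.inr (Or.inr ⟨j, by simp⟩))).le

end Zigzag

/-- The superposition of the zigzags `zigzag (ℓ k) (σ k)`. -/
noncomputable def zigzagSup (ℓ σ : ℕ → ℕ) (x : ℝ) : ℝ :=
  ⨆ k, zigzag (ℓ k) (σ k) x

section ZigzagSup

variable {ℓ σ : ℕ → ℕ}

theorem two_pow_inv_le_one (n : ℕ) : ((2 : ℝ) ^ n)⁻¹ ≤ 1 :=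
  inv_le_one_of_one_le₀ (one_le_pow₀ one_le_two)

theorem bddAbove_zigzag (ℓ σ : ℕ → ℕ) (x : ℝ) :
    BddAbove (Set.range fun k => zigzag (ℓ k) (σ k) x) := by
  refine ⟨4, ?_⟩
  rintro _ ⟨k, rfl⟩
  linarith [zigzag_le (ℓ := ℓ k) (σ := σ k) x, two_pow_inv_le_one (ℓ k)]

theorem zigzagSup_nonneg (x : ℝ) : 0 ≤ zigzagSup ℓ σ x :=
  Real.iSup_nonneg fun _ => zigzag_nonneg _

theorem zigzagSup_le (hℓ : Monotone ℓ) (x : ℝ) : zigzagSup ℓ σ x ≤ 4 * ((2 : ℝ) ^ ℓ 0)⁻¹ :=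
  ciSup_le fun k => (zigzag_le x).trans (by
    gcongr
    · exact one_le_two
    · exact hℓ (Nat.zero_le k))

theorem zigzagSup_modulus {x y V : ℝ}
    (hV : ∀ k, min (2 ^ σ k * |x - y|) ((2 : ℝ) ^ ℓ k)⁻¹ ≤ V) :
    |zigzagSup ℓ σ x - zigzagSup ℓ σ y| ≤ 4 * V := by
  have key : ∀ u v : ℝ, |u - v| = |x - y| → zigzagSup ℓ σ u ≤ zigzagSup ℓ σ v + 4 * V := by
    intro u v huv
    refine ciSup_le fun k => ?_
    have h1 := le_ciSup (bddAbove_zigzag ℓ σ v) k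
    have h2 := (abs_le.1 (zigzag_modulus (ℓ := ℓ k) (σ := σ k) u v)).2
    have h3 := hV k
    rw [← huv] at h3
    rw [zigzagSup]
    linarith
  rw [abs_le]
  constructor <;> linarith [key x y rfl, key y x (abs_sub_comm y x)]

/-- Strict growth of `ℓ` makes the supporting intervals overlap at most at endpoints. -/
theorem zigzagSup_eq (hℓ : StrictMono ℓ) {k : ℕ} {x : ℝ}
    (hx : x ∈ Set.Icc ((2 : ℝ) ^ ℓ k)⁻¹ (2 * ((2 : ℝ) ^ ℓ k)⁻¹)) :
    zigzagSup ℓ σ x = zigzag (ℓ k) (σ k) x := by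
  have two_mul_le : ∀ i j : ℕ, i < j → 2 * ((2 : ℝ) ^ ℓ j)⁻¹ ≤ ((2 : ℝ) ^ ℓ i)⁻¹ := by
    intro i j hij
    have h1 : (2 : ℝ) ^ (ℓ i + 1) ≤ 2 ^ ℓ j := pow_le_pow_right₀ one_le_two (hℓ hij)
    rw [← div_eq_mul_inv, div_le_iff₀ (by positivity), inv_mul_eq_div, le_div_iff₀ (by positivity)]
    rw [pow_succ] at h1
    linarith
  refine le_antisymm (ciSup_le fun j => ?_) (le_ciSup (bddAbove_zigzag ℓ σ x) k)
  rcases lt_trichotomy j k with h | rfl | h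
  · rw [zigzag_eq_zero (Or.inl (hx.2.trans (two_mul_le j k h)))]
    exact zigzag_nonneg _
  · exact le_rfl
  · rw [zigzag_eq_zero (Or.inr (Or.inl ((two_mul_le k j h).trans hx.1)))]
    exact zigzag_nonneg _

theorem continuous_zigzagSup (hℓ : StrictMono ℓ) (hσ : Monotone σ) : Continuous (zigzagSup ℓ σ) := by
  refine Metric.continuous_iff.2 fun y δ hδ => ?_
  have hlim : Tendsto (fun k => ((2 : ℝ) ^ ℓ k)⁻¹) atTop (𝓝 0) :=
    tendsto_nhds_of_tendsto_nhdsWithin (tendsto_two_pow_inv_nhdsGT hℓ.tendsto_atTop)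
  obtain ⟨K, hK⟩ := eventually_atTop.1 (hlim.eventually_lt_const (show 0 < δ / 8 by positivity))
  refine ⟨δ / 8 / 2 ^ σ K, by positivity, fun x hx => ?_⟩
  rw [Real.dist_eq] at hx ⊢
  refine (zigzagSup_modulus (V := δ / 8) fun k => ?_).trans_lt (by linarith)
  rcases le_or_gt K k with hk | hk
  · exact (min_le_right _ _).trans (hK k hk).le
  · refine (min_le_left _ _).trans ?_
    rw [lt_div_iff₀ (by positivity), mul_comm] at hx
    refine le_trans ?_ hx.le
    gcongr
    · exact one_le_two
    · exact hσ hk.le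

end ZigzagSup

/-- Keep the rising half of every `2 ^ ρ`-th leg. With leg width `w`, the gaps are at least `2 ^ ρ *
w - w / 2`, which exceeds `2 ^ ρ * w / 4`. -/
theorem le_sepEntropy_of_eq_zigzag {φ : unitInterval → unitInterval} {ℓ σ ρ : ℕ} {c : ℝ}
    (hρ : ρ ≤ σ) (hc : 0 ≤ c) (hc1 : c + 2 * ((2 : ℝ) ^ ℓ)⁻¹ ≤ 1)
    (hφ : ∀ x : unitInterval, (x : ℝ) - c ∈ Set.Icc ((2 : ℝ) ^ ℓ)⁻¹ (2 * ((2 : ℝ) ^ ℓ)⁻¹) →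
      (φ x : ℝ) = c + zigzag ℓ σ (x - c)) :
    ((((σ : ℝ) - ρ) * Real.log 2 : ℝ) : EReal) ≤
      sepEntropy φ (2 ^ ρ * ((2 : ℝ) ^ (ℓ + σ + 2))⁻¹) := by
  have hL := two_pow_mul_inv ℓ σ
  have hw4 : ((2 : ℝ) ^ (ℓ + σ + 2))⁻¹ = ((2 : ℝ) ^ (ℓ + σ))⁻¹ / 4 := by
    rw [pow_add _ (ℓ + σ) 2, mul_inv, div_eq_mul_inv]
    norm_num
  rw [hw4]
  set w := ((2 : ℝ) ^ (ℓ + σ))⁻¹ with hw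
  have hw0 : 0 < w := by positivity
  have hlog : ((σ : ℝ) - ρ) * Real.log 2 = Real.log ((2 ^ (σ - ρ) : ℕ) : ℝ) := by
    push_cast
    rw [Real.log_pow, Nat.cast_sub hρ]
  rw [hlog]
  set J : Set ℝ := Set.Icc ((2 : ℝ) ^ ℓ)⁻¹ (2 * ((2 : ℝ) ^ ℓ)⁻¹) with hJ
  have hL0 : 0 < ((2 : ℝ) ^ ℓ)⁻¹ := by positivity
  have hmem : ∀ y ∈ J, c + y ∈ unitInterval := fun y hy =>
    ⟨by linarith [hy.1], by linarith [hy.2]⟩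
  set leg : Fin (2 ^ (σ - ρ)) → ℕ := fun i => 2 ^ σ + 2 ^ ρ * i with hleg
  have hleg1 : ∀ i, 2 ^ σ ≤ leg i := fun i => Nat.le_add_right _ _
  have hleg2 : ∀ i, leg i < 2 * 2 ^ σ := fun i => by
    have h1 : 2 ^ ρ * (i : ℕ) < 2 ^ ρ * 2 ^ (σ - ρ) :=
      Nat.mul_lt_mul_of_pos_left i.2 (by positivity)
    rw [← pow_add, Nat.add_sub_cancel' hρ] at h1
    simp only [hleg]
    omega
  have hsub : ∀ i, Set.Icc (leg i * w) ((leg i + 1 / 2) * w) ⊆ J := fun i => by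
    have h1 : (2 : ℝ) ^ σ ≤ leg i := by exact_mod_cast hleg1 i
    have h2 : (leg i : ℝ) + 1 ≤ 2 * 2 ^ σ := by exact_mod_cast hleg2 i
    rw [hJ, ← hL, ← mul_assoc]
    refine Set.Icc_subset_Icc ?_ ?_ <;> gcongr
    linarith
  have hsepLt : ∀ i j : Fin (2 ^ (σ - ρ)), i < j → ∀ x y : ℝ, x ≤ (leg i + 1 / 2) * w →
      leg j * w ≤ y → 2 ^ ρ * (w / 4) < y - x := by
    intro i j hij x y hx hy
    have h1 : leg i + 2 ^ ρ ≤ leg j := by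
      have : 2 ^ ρ * ((i : ℕ) + 1) ≤ 2 ^ ρ * (j : ℕ) := Nat.mul_le_mul_left _ hij
      simp only [hleg]
      linarith
    have h2 : (leg i : ℝ) + 2 ^ ρ ≤ leg j := by exact_mod_cast h1
    have h3 := mul_le_mul_of_nonneg_right h2 hw0.le
    have h4 : 1 * w ≤ 2 ^ ρ * w := by
      gcongr
      exact one_le_pow₀ one_le_two
    linarith
  refine log_le_sepEntropy (by positivity) {x : unitInterval | (x : ℝ) - c ∈ J}
    (fun i => {x : unitInterval | (x : ℝ) - c ∈ Set.Icc (leg i * w) ((leg i + 1 / 2) * w)})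
    ?_ (by positivity) (fun i x hx => hsub i hx) ?_ ?_
  · have h0 : ((2 : ℝ) ^ ℓ)⁻¹ ∈ J := ⟨le_rfl, by linarith⟩
    exact ⟨⟨_, hmem _ h0⟩, by simpa using h0⟩
  · intro i z hz
    obtain ⟨y, hy, hyz⟩ := zigzag_surjOn (ℓ := ℓ) (hleg1 i) (hleg2 i)
      (show (z : ℝ) - c ∈ _ from ⟨hL0.le.trans hz.1, hz.2⟩)
    refine ⟨⟨c + y, hmem y (hsub i hy)⟩, by
      rwa [Set.mem_ofPred_eq, add_sub_cancel_left], Subtype.ext ?_⟩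
    rw [hφ _ (by simpa using hsub i hy), add_sub_cancel_left, hyz]
    ring
  · intro i j hij x hx y hy
    rw [Subtype.dist_eq, Real.dist_eq]
    rcases hij.lt_or_gt with h | h
    · have := hsepLt i j h _ _ hx.2 hy.1
      rw [abs_sub_comm]
      exact (by linarith : 2 ^ ρ * (w / 4) < (y : ℝ) - x).trans_le (le_abs_self _)
    · have := hsepLt j i h _ _ hy.2 hx.1
      exact (by linarith : 2 ^ ρ * (w / 4) < (x : ℝ) - y).trans_le (le_abs_self _)

/-! ### Clamping near a given map -/

/-- The map of `[0, 1]` that follows `h` as long as it is `η`-close to `g`. -/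
noncomputable def clampNear (g h : ℝ → ℝ) (η : ℝ) (x : ℝ) : unitInterval :=
  Set.projIcc 0 1 zero_le_one (max (min (h x) (g x + η)) (g x - η))

section ClampNear

variable {g h : ℝ → ℝ} {η : ℝ}

theorem Continuous.clampNear (hg : Continuous g) (hh : Continuous h) :
    Continuous (clampNear g h η) :=
  continuous_projIcc.comp ((hh.min (hg.add_const η)).max (hg.sub continuous_const))

theorem clampNear_eq {x : ℝ} (hx : h x ∈ unitInterval) (hgh : |h x - g x| ≤ η) :
    (clampNear g h η x : ℝ) = h x := by
  rw [abs_le] at hgh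
  rw [clampNear, min_eq_left (by linarith), max_eq_left (by linarith),
    Set.projIcc_of_mem zero_le_one hx]

theorem dist_clampNear_le (hη : 0 ≤ η) (x : ℝ) (y : unitInterval) :
    dist (clampNear g h η x) y ≤ η + |g x - y| := by
  have h1 := (LipschitzWith.projIcc (zero_le_one (α := ℝ))).dist_le_mul
    (max (min (h x) (g x + η)) (g x - η)) y
  rw [Set.projIcc_val, NNReal.coe_one, one_mul, Real.dist_eq] at h1
  refine h1.trans ?_
  have h2 : |max (min (h x) (g x + η)) (g x - η) - g x| ≤ η := by
    rw [abs_le]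
    refine ⟨by linarith [le_max_right (min (h x) (g x + η)) (g x - η)], ?_⟩
    rw [sub_le_iff_le_add, max_le_iff]
    exact ⟨(min_le_right _ _).trans (by linarith), by linarith⟩
  exact (abs_sub_le _ (g x) _).trans (by linarith)

/-- Moduli combine by a maximum, so no gluing of `g` and `h` is needed. -/
theorem dist_clampNear_clampNear_le (x y : ℝ) :
    dist (clampNear g h η x) (clampNear g h η y) ≤ max |h x - h y| |g x - g y| := by
  have h1 := (LipschitzWith.projIcc (zero_le_one (α := ℝ))).dist_le_mul
    (max (min (h x) (g x + η)) (g x - η)) (max (min (h y) (g y + η)) (g y - η))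
  rw [NNReal.coe_one, one_mul, Real.dist_eq] at h1
  refine h1.trans ((abs_max_sub_max_le_max _ _ _ _).trans ?_)
  rw [sub_sub_sub_cancel_right]
  refine max_le ((abs_min_sub_min_le_max _ _ _ _).trans ?_) (le_max_right _ _)
  rw [add_sub_add_right_eq_sub]

end ClampNear

/-! ### Density -/

theorem exists_lipschitz_near (ψ : C(unitInterval, unitInterval)) {η : ℝ} (hη : 0 < η) :
    ∃ (g : ℝ → ℝ) (K : NNReal), Continuous g ∧ LipschitzOnWith K g unitInterval ∧
      ∀ x : unitInterval, |g x - ψ x| < η := by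
  obtain ⟨p, hp⟩ := exists_polynomial_near_of_continuousOn 0 1
    (fun x => (ψ (Set.projIcc 0 1 zero_le_one x) : ℝ)) (by fun_prop) η hη
  obtain ⟨K, hK⟩ := ((show ContDiff ℝ 1 fun x => p.eval x by
    simpa [Polynomial.coe_aeval_eq_eval] using Polynomial.contDiff_aeval (𝕜 := ℝ) p 1).locallyLipschitz.locallyLipschitzOn
    (s := unitInterval)).exists_lipschitzOnWith_of_compact isCompact_Icc
  exact ⟨fun x => p.eval x, K, p.continuous, hK, fun x => by simpa using hp x x.2⟩

theorem exists_fixedPoint (ψ : C(unitInterval, unitInterval)) : ∃ x, ψ x = x := by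
  obtain ⟨x, hx, hfix⟩ := exists_mem_Icc_isFixedPt_of_mapsTo
    (f := fun x : ℝ => (ψ (Set.projIcc 0 1 zero_le_one x) : ℝ)) (a := 0) (b := 1)
    (by fun_prop) zero_le_one (fun x _ => (ψ _).2)
  refine ⟨⟨x, hx⟩, Subtype.ext ?_⟩
  simpa [Function.IsFixedPt, Set.projIcc_of_mem zero_le_one hx] using hfix

theorem mainTheorem3 (a b : ℝ) (ha : a ∈ Set.Icc (0 : ℝ) 1) (hb : b ∈ Set.Icc (0 : ℝ) 1)
    (hab : a < b) :
    Dense {φ : C(unitInterval, unitInterval) |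
      lowerMetricMeanDim (⇑φ : unitInterval → unitInterval) = ((a : ℝ) : EReal) ∧
      upperMetricMeanDim (⇑φ : unitInterval → unitInterval) = ((b : ℝ) : EReal)} := by
  refine Metric.dense_iff.2 fun ψ r hr => ?_
  obtain ⟨g, K, hg, hgK, hgψ⟩ := exists_lipschitz_near ψ (show 0 < r / 4 by positivity)
  obtain ⟨x₀, hx₀⟩ := exists_fixedPoint ψ
  have hsmall : Tendsto (fun n : ℕ => 4 * ((2 : ℝ) ^ n)⁻¹ * (1 + K)) atTop (𝓝 0) := by
    simpa using ((tendsto_nhds_of_tendsto_nhdsWithin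
      (tendsto_two_pow_inv_nhdsGT tendsto_id)).const_mul 4).mul_const (1 + (K : ℝ))
  obtain ⟨m, hm⟩ := eventually_atTop.1
    (hsmall.eventually_lt_const (show 0 < r / 4 by positivity))
  obtain ⟨ℓ, σ, hℓ0, hs⟩ := exists_horseshoeScales ha.1 hb.2 hab (max m 2)
  have hL := hm (ℓ 0) ((le_max_left _ _).trans hℓ0)
  have hL4 : 4 * ((2 : ℝ) ^ ℓ 0)⁻¹ ≤ 1 := by
    have : (2 : ℝ) ^ 2 ≤ 2 ^ ℓ 0 := pow_le_pow_right₀ one_le_two ((le_max_right _ _).trans hℓ0)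
    rw [← div_eq_mul_inv, div_le_one (by positivity)]
    linarith
  set L := ((2 : ℝ) ^ ℓ 0)⁻¹ with hLdef
  have hL0 : 0 < L := by positivity
  have hLk : ∀ k, ((2 : ℝ) ^ ℓ k)⁻¹ ≤ L := fun k => by
    rw [hLdef]
    gcongr
    · exact one_le_two
    · exact hs.strictMono.monotone (Nat.zero_le k)
  -- Shifted left if `x₀` is too close to 1, so that `[c, c + 4 * L]` lies in `[0, 1]` and still
  -- contains `x₀`.
  set c := min (x₀ : ℝ) (1 - 4 * L) with hc
  have hc0 : 0 ≤ c := le_min x₀.2.1 (by linarith)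
  have hc1 : c + 4 * L ≤ 1 := by linarith [min_le_right (x₀ : ℝ) (1 - 4 * L)]
  have hcx : c ≤ x₀ := min_le_left _ _
  have hxc : (x₀ : ℝ) ≤ c + 4 * L := by
    rcases min_choice (x₀ : ℝ) (1 - 4 * L) with h | h <;> rw [hc, h] <;> linarith [x₀.2.2]
  set h : ℝ → ℝ := fun x => c + zigzagSup ℓ σ (x - c) with hh
  have hhc : Continuous h := continuous_const.add
    ((continuous_zigzagSup hs.strictMono hs.mono).comp (continuous_id.sub continuous_const))
  set φ : C(unitInterval, unitInterval) := ⟨fun x => clampNear g h (r / 2) x,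
    (hg.clampNear hhc).comp continuous_subtype_val⟩ with hφ
  have hK0 : (0 : ℝ) ≤ K := K.2
  refine ⟨φ, ?_, hs.metricMeanDim_eq ha hb (C := 4 + K) (by positivity) ?_ ?_⟩
  · rw [Metric.mem_ball, ContinuousMap.dist_lt_iff hr]
    intro x
    have h1 := dist_clampNear_le (g := g) (h := h) (η := r / 2) (by positivity) x (ψ x)
    have h2 := hgψ x
    exact h1.trans_lt (by linarith)
  · intro ε V hε hεV hV x y hxy
    refine (dist_clampNear_clampNear_le (x : ℝ) y).trans (max_le ?_ ?_)
    · have hxy' : |(x - c : ℝ) - (y - c)| ≤ ε := by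
        rwa [sub_sub_sub_cancel_right, ← Real.dist_eq, ← Subtype.dist_eq]
      have := zigzagSup_modulus (ℓ := ℓ) (σ := σ) (x := x - c) (y := y - c) (V := V)
        fun k => le_trans (by gcongr) (hV k)
      rw [hh, add_sub_add_left_eq_sub]
      refine this.trans ?_
      gcongr
      · exact hε.le.trans hεV
      · linarith
    · have := hgK.dist_le_mul x x.2 y y.2
      rw [← Real.dist_eq]
      refine this.trans ?_
      rw [← Subtype.dist_eq]
      gcongr
      · linarith
      · exact hxy.trans hεV
  · intro k ρ hρ
    refine le_sepEntropy_of_eq_zigzag hρ hc0 (by linarith [hLk k]) fun x hx => ?_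
    rw [← zigzagSup_eq hs.strictMono hx]
    have h0 := zigzagSup_nonneg (ℓ := ℓ) (σ := σ) (x - c)
    have h4 := zigzagSup_le (σ := σ) hs.strictMono.monotone (x - c)
    -- The clamp is inactive: `h x`, `x₀`, `g x₀`, `g x` are successively within `4 * L`, `r / 4`
    -- and `4 * L * K`, for a total below `r / 2` by `hL`.
    refine clampNear_eq (g := g) (h := h) ⟨by positivity, by simp only [hh]; linarith⟩ ?_
    have e1 : |h x - x₀| ≤ 4 * L := by
      rw [abs_le]
      constructor <;> simp only [hh] <;> linarith
    have hx1 := hx.1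
    have hx2 := hx.2
    have hk0 : 0 < ((2 : ℝ) ^ ℓ k)⁻¹ := by positivity
    have e2 : |(x₀ : ℝ) - x| ≤ 4 * L := by
      rw [abs_le]
      constructor <;> linarith [hLk k]
    have e3 : |g x₀ - g x| ≤ K * (4 * L) := by
      have := hgK.dist_le_mul x₀ x₀.2 x x.2
      rw [Real.dist_eq, Real.dist_eq] at this
      exact this.trans (by gcongr)
    have e4 := hgψ x₀
    rw [hx₀, abs_sub_comm] at e4
    have e5 := abs_sub_le (h x) (x₀ : ℝ) (g x)
    have e6 := abs_sub_le (x₀ : ℝ) (g x₀) (g x)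
    linarith
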